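/- A generalized Haar system is defined as follows. Let $\mathcal A_1,\mathcal A_2,\dots$ be partitions of $[0,1)$ into intervals $[\alpha,\beta)$, $\alpha<\beta$, such that $\mathcal A_1=\{[0,1)\}$; for every $n\ge 1$, $\mathcal A_{n+1}$ is obtained from $\mathcal A_n$ by splitting one of its intervals into two (not necessarily equal) intervals and keeping all the others; and $\max_{A\in\mathcal A_n}|A|\to 0$ as $n\to\infty$. A sequence of real functions $f_n$, $n=1,2,\dots$, in $L^1(0,1)$ is a generalized Haar system if, for some such sequence of partitions, every $f_n$ is constant on each $A\in\mathcal A_n$, $\int_A f_n=0$ for every $A\in\mathcal A_{n-1}$, $n\ge 2$, and $\|f_n\|_{L^2(0,1)}=1$ for all $n\geq 1$. Let $\{f_n\}_{n\ge1}$ be a generalized Haar system and let $\sigma$ be a permutation of $\{1,2,\dots\}$. Then $\{f_{\sigma(n)}\}_{n\ge1}$ is an orthonormal system in $L^2(0,1)$, and the sequence $\log_2 n$ (which is nonnegative and increases to infinity) is an a.e. convergence Weyl multiplier for it: for all real numbers $a_1,a_2,\dots$ with $\sum_{n=1}^\infty a_n^2\log_2 n<\infty$, the series $$\sum_{n=1}^\infty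 a_n f_{\sigma(n)}(x)$$ converges for almost every $x\in[0,1)$. -/

import Mathlib

open Filter Topology MeasureTheory

namespace GenHaar

/-- Lebesgue measure on `[0,1)`. -/
noncomputable def unitMeasure : Measure ℝ := volume.restrict (Set.Ico 0 1)

/-- A (countable, measurable) partition of `[0,1)` into pairwise disjoint nonempty sets. -/
structure IsPartition (P : Set (Set ℝ)) : Prop where
  countable : P.Countable
  measurableSet : ∀ A ∈ P, MeasurableSet A
  nonempty : ∀ A ∈ P, A.Nonempty
  pairwiseDisjoint : P.PairwiseDisjoint id
  sUnion_eq : ⋃₀ P = Set.Ico 0 1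

/-- A filtration: a sequence of partitions of `[0,1)` such that every element of a partition is a
union of elements of the next one. (Sequences are indexed by `ℕ`, starting at `0`.) -/
structure IsFiltration (𝒜 : ℕ → Set (Set ℝ)) : Prop where
  isPartition : ∀ n, IsPartition (𝒜 n)
  union_of_next : ∀ n, ∀ A ∈ 𝒜 n, ∃ S ⊆ 𝒜 (n + 1), A = ⋃₀ S

/-- The children, in `𝒜 (n + 1)`, of an element `A` of `𝒜 n`. -/
def children (𝒜 : ℕ → Set (Set ℝ)) (n : ℕ) (A : Set ℝ) : Set (Set ℝ) :=
  {B | B ∈ 𝒜 (n + 1) ∧ B ⊆ A}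

/-- `f` is a martingale difference based on the filtration `𝒜`: each `f n` is integrable on `[0,1)`
and constant on every element of `𝒜 n`, and `f (n + 1)` has integral zero over every element
of `𝒜 n`. -/
structure IsMartingaleDifference (𝒜 : ℕ → Set (Set ℝ)) (f : ℕ → ℝ → ℝ) : Prop where
  isFiltration : IsFiltration 𝒜
  integrable : ∀ n, Integrable (f n) unitMeasure
  const_on : ∀ n, ∀ A ∈ 𝒜 n, ∀ x ∈ A, ∀ y ∈ A, f n x = f n y
  integral_eq_zero : ∀ n, ∀ A ∈ 𝒜 n, ∫ x in A, f (n + 1) x = 0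

/-- The filtrations underlying generalized Haar systems: start from the single interval `[0,1)`;
at each step one interval of the current partition is replaced by two children intervals (not
necessarily of equal length), all other intervals being kept; the maximal length of the intervals
tends to zero (so that every interval is split sooner or later). -/
structure IsHaarFiltration (𝒜 : ℕ → Set (Set ℝ)) : Prop where
  isFiltration : IsFiltration 𝒜
  zero : 𝒜 0 = {Set.Ico 0 1}
  split : ∀ n, ∃ a c b : ℝ, a < c ∧ c < b ∧ Set.Ico a b ∈ 𝒜 n ∧
    children 𝒜 n (Set.Ico a b) = {Set.Ico a c, Set.Ico c b} ∧
    ∀ B ∈ 𝒜 n, B ≠ Set.Ico a b → children 𝒜 n B = {B}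
  mesh : Tendsto (fun n => ⨆ A ∈ 𝒜 n, volume A) atTop (𝓝 0)

/-- A generalized Haar system: an `L²`-normalized martingale difference based on a filtration as
above. -/
def IsGeneralizedHaarSystem (f : ℕ → ℝ → ℝ) : Prop :=
  ∃ 𝒜 : ℕ → Set (Set ℝ), IsHaarFiltration 𝒜 ∧ IsMartingaleDifference 𝒜 f ∧
    ∀ n, eLpNorm (f n) 2 unitMeasure = 1

/-- Orthonormal systems of real functions in `L²(0,1)`. -/
structure IsOrthonormalSystem (φ : ℕ → ℝ → ℝ) : Prop where
  memLp : ∀ n, MemLp (φ n) 2 unitMeasure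
  norm_eq_one : ∀ n, ∫ x, φ n x ^ 2 ∂unitMeasure = 1
  orthogonal : ∀ m n, m ≠ n → ∫ x, φ m x * φ n x ∂unitMeasure = 0

/-- `ω` is an a.e. convergence Weyl multiplier (C-multiplier) for the orthonormal system `φ`:
`ω` is nonnegative and increases to infinity, and `∑ aₙ φₙ` converges a.e. on `[0,1)` whenever
`∑ aₙ² ωₙ < ∞`. (Nonnegativity, rather than positivity, admits `log n`, which vanishes at its first
term.) -/
structure IsCMultiplier (ω : ℕ → ℝ) (φ : ℕ → ℝ → ℝ) : Prop where
  orthonormal : IsOrthonormalSystem φ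
  nonneg : ∀ n, 0 ≤ ω n
  monotone : Monotone ω
  tendsto_atTop : Tendsto ω atTop atTop
  ae_convergent : ∀ a : ℕ → ℝ, Summable (fun n => a n ^ 2 * ω n) →
    ∀ᵐ x ∂unitMeasure, ∃ s : ℝ,
      Tendsto (fun N => ∑ n ∈ Finset.range N, a n * φ n x) atTop (𝓝 s)

end GenHaar

/-!
Since `exp (x - x²) ≤ 1 + x + x²`, a square-integrable martingale difference `d` satisfies
`𝔼[exp (t dₙ - t² (dₙ² + 𝔼[dₙ² | ℱₙ₋₁])) | ℱₙ₋₁] ≤ 1`. Integrating out the largest index first,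
`exp (t T - t² Q)`, with `T = ∑ dₙ` and `Q = ∑ (dₙ² + 𝔼[dₙ² | ℱₙ₋₁])` over an *arbitrary* finite set
of indices, has bounded integral; this is where the order of summation becomes irrelevant. The block
`2 ^ 2 ^ k ≤ n < 2 ^ 2 ^ (k + 1)` of the rearranged series has at most `exp (2 ^ (k + 1))` partial
sums, so by Borel–Cantelli at level `exp (4 * 2 ^ k)` with `t = ± L * 2 ^ k` they are all bounded by
`4 / L + L * 2 ^ k * Q` for large `k`. The logarithmic weight makes `∑ 2 ^ k * Q` converge almost
everywhere, so letting `L` grow, the oscillation within the blocks tends to zero. The sums over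
whole blocks are summable by orthogonality.
-/

namespace GenHaar

section RealSeries

lemma exp_sub_sq_le (x : ℝ) : Real.exp (x - x ^ 2) ≤ 1 + x + x ^ 2 := by
  have hpos : 0 < 1 - x + x ^ 2 := by nlinarith [sq_nonneg (x - 1 / 2)]
  have hexp : 1 - x + x ^ 2 ≤ Real.exp (-(x - x ^ 2)) := by
    linarith [Real.one_sub_le_exp_neg (x - x ^ 2)]
  calc Real.exp (x - x ^ 2) = (Real.exp (-(x - x ^ 2)))⁻¹ := by rw [Real.exp_neg, inv_inv]
    _ ≤ (1 - x + x ^ 2)⁻¹ := inv_anti₀ hpos hexp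
    _ ≤ 1 + x + x ^ 2 := by
      rw [inv_le_iff_one_le_mul₀ hpos]
      nlinarith [sq_nonneg x, sq_nonneg (x ^ 2)]

lemma abs_le_of_mul_sub_sq_mul_le {t T q M : ℝ} (ht : 0 < t) (hpos : t * T - t ^ 2 * q ≤ M)
    (hneg : -t * T - (-t) ^ 2 * q ≤ M) : |T| ≤ M / t + t * q := by
  have habs : t * |T| ≤ M + t ^ 2 * q := by
    rcases abs_cases T with ⟨h, -⟩ | ⟨h, -⟩ <;> rw [h] <;> linarith
  calc |T| ≤ (M + t ^ 2 * q) / t := by rwa [le_div_iff₀' ht]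
    _ = M / t + t * q := by field_simp

lemma summable_of_summable_mul_sq {ι : Type*} {w c : ι → ℝ} (hw : ∀ i, 0 < w i)
    (hinv : Summable fun i => (w i)⁻¹) (hsq : Summable fun i => w i * c i ^ 2) : Summable c := by
  refine Summable.of_norm_bounded (hsq.add hinv) fun i => ?_
  have hamgm : 2 * |c i| ≤ w i * c i ^ 2 + (w i)⁻¹ := by
    have hsquare : (w i)⁻¹ * (w i * |c i| - 1) ^ 2 = w i * c i ^ 2 - 2 * |c i| + (w i)⁻¹ := by
      rw [← sq_abs (c i)]
      field_simp [(hw i).ne']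
      ring
    linarith [mul_nonneg (inv_pos.2 (hw i)).le (sq_nonneg (w i * |c i| - 1))]
  rw [Real.norm_eq_abs]
  linarith [abs_nonneg (c i)]

lemma sum_range_sum_Ico {M : Type*} [AddCommMonoid M] {N : ℕ → ℕ} (hN : Monotone N) (c : ℕ → M)
    (K : ℕ) : ∑ k ∈ Finset.range K, ∑ n ∈ Finset.Ico (N k) (N (k + 1)), c n =
      ∑ n ∈ Finset.Ico (N 0) (N K), c n := by
  induction K with
  | zero => simp
  | succ K ih =>
    rw [Finset.sum_range_succ, ih, Finset.sum_Ico_consecutive c (hN K.zero_le) (hN K.le_succ)]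

lemma exists_mem_Ico_of_le {N : ℕ → ℕ} (hN : StrictMono N) {K n : ℕ} (hn : N K ≤ n) :
    ∃ k ≥ K, n ∈ Finset.Ico (N k) (N (k + 1)) := by
  have hcover := biUnion_Ici_Ico_map_succ (f := N) (a := K) (fun _ hk => hN.monotone hk)
    fun ⟨B, hB⟩ => absurd (hB ⟨max K (B + 1), le_max_left K (B + 1), rfl⟩)
      (hN.le_apply.trans_lt' (lt_max_of_lt_right B.lt_succ_self)).not_ge
  simpa [and_left_comm] using hcover.ge hn

lemma exists_tendsto_sum_range_of_blocks {E : Type*} [SeminormedAddCommGroup E] {N : ℕ → ℕ}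
    (hN : StrictMono N) {c : ℕ → E}
    (hsum : Summable fun k => ∑ n ∈ Finset.Ico (N k) (N (k + 1)), c n)
    (hosc : ∀ ε > 0, ∀ᶠ k in atTop, ∀ m ∈ Finset.Ico (N k) (N (k + 1)),
      ‖∑ n ∈ Finset.Ico (N k) m, c n‖ ≤ ε) :
    ∃ s, Tendsto (fun n => ∑ i ∈ Finset.range n, c i) atTop (𝓝 s) := by
  obtain ⟨S, hS⟩ := hsum
  have hsub : Tendsto (fun k => ∑ i ∈ Finset.range (N k), c i) atTop
      (𝓝 (∑ i ∈ Finset.range (N 0), c i + S)) := by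
    refine (hS.tendsto_sum_nat.const_add _).congr fun k => ?_
    rw [sum_range_sum_Ico hN.monotone, Finset.sum_range_add_sum_Ico c (hN.monotone k.zero_le)]
  refine ⟨∑ i ∈ Finset.range (N 0), c i + S, Metric.tendsto_atTop.2 fun ε hε => ?_⟩
  obtain ⟨K, hK⟩ := eventually_atTop.1
    ((Metric.tendsto_nhds.1 hsub (ε / 2) (half_pos hε)).and (hosc (ε / 3) (by positivity)))
  refine ⟨N K, fun n hn => ?_⟩
  obtain ⟨k, hkK, hk⟩ := exists_mem_Ico_of_le hN hn
  obtain ⟨hnear, hblock⟩ := hK k hkK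
  rw [← Finset.sum_range_add_sum_Ico c (Finset.mem_Ico.1 hk).1, dist_eq_norm, add_sub_right_comm]
  rw [dist_eq_norm] at hnear
  linarith [norm_add_le (∑ i ∈ Finset.range (N k), c i - (∑ i ∈ Finset.range (N 0), c i + S))
    (∑ i ∈ Finset.Ico (N k) n, c i), hblock n hk]

lemma eventually_forall_mem_le_of_tendsto_zero {ι : Type*} {s : ℕ → Finset ι} {g : ℕ → ι → ℝ}
    {a : ℕ → ℝ} {C : ℝ} (ha : Tendsto a atTop (𝓝 0))
    (hg : ∀ L : ℕ, ∀ᶠ k in atTop, ∀ i ∈ s k, g k i ≤ C / (L + 1) + (L + 1) * a k) :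
    ∀ ε > 0, ∀ᶠ k in atTop, ∀ i ∈ s k, g k i ≤ ε := fun ε hε => by
  obtain ⟨L, hL⟩ : ∃ L : ℕ, C / (L + 1) < ε :=
    ((tendsto_const_div_atTop_nhds_zero_nat C).comp (tendsto_add_atTop_nat 1)).eventually
      (gt_mem_nhds hε) |>.exists.imp fun L hL => by simpa using hL
  have hlim : Tendsto (fun k => C / (L + 1) + (L + 1) * a k) atTop (𝓝 (C / (L + 1))) := by
    simpa using (ha.const_mul ((L : ℝ) + 1)).const_add (C / (L + 1))
  filter_upwards [hg L, hlim.eventually_le_const hL] with k hk hk' i hi using (hk i hi).trans hk'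

end RealSeries

section Blocks

/-- The endpoints `2 ^ 2 ^ k` of the blocks into which a rearranged series is cut: between two
consecutive ones, `log₂ n` stays within a factor `2` of `2 ^ k`. -/
def blockEnd (k : ℕ) : ℕ := 2 ^ 2 ^ k

lemma strictMono_blockEnd : StrictMono blockEnd :=
  (pow_right_strictMono₀ one_lt_two).comp (pow_right_strictMono₀ one_lt_two)

lemma blockEnd_le_exp (k : ℕ) : (blockEnd k : ℝ) ≤ Real.exp (2 ^ k) := by
  have htwo : (2 : ℝ) ≤ Real.exp 1 := by linarith [Real.add_one_le_exp (1 : ℝ)]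
  calc (blockEnd k : ℝ) = 2 ^ 2 ^ k := by simp [blockEnd]
    _ ≤ Real.exp 1 ^ 2 ^ k := by gcongr
    _ = Real.exp (2 ^ k) := by rw [← Real.exp_nat_mul]; simp

lemma two_pow_le_logb {k n : ℕ} (hn : blockEnd k ≤ n) : (2 : ℝ) ^ k ≤ Real.logb 2 (n + 1) := by
  rw [Real.le_logb_iff_rpow_le one_lt_two (by positivity)]
  calc (2 : ℝ) ^ (2 ^ k : ℝ) = 2 ^ ((2 ^ k : ℕ) : ℝ) := by push_cast; rfl
    _ = blockEnd k := by rw [Real.rpow_natCast, blockEnd, Nat.cast_pow, Nat.cast_ofNat]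
    _ ≤ n + 1 := by exact_mod_cast hn.trans n.le_succ

lemma logb_two_natCast_add_one_nonneg (n : ℕ) : 0 ≤ Real.logb 2 ((n : ℝ) + 1) :=
  Real.logb_nonneg one_lt_two (by simp)

lemma monotone_logb_two_natCast_add_one : Monotone fun n : ℕ => Real.logb 2 ((n : ℝ) + 1) :=
  fun m n hmn => Real.logb_le_logb_of_le one_lt_two m.cast_add_one_pos (by gcongr)

lemma tendsto_logb_two_natCast_add_one_atTop :
    Tendsto (fun n : ℕ => Real.logb 2 ((n : ℝ) + 1)) atTop atTop :=
  (Real.tendsto_logb_atTop one_lt_two).comp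
    (tendsto_atTop_add_const_right _ _ tendsto_natCast_atTop_atTop)

lemma summable_two_pow_mul_block {b : ℕ → ℝ} (hb : ∀ n, 0 ≤ b n)
    (hsum : Summable fun n : ℕ => b n * Real.logb 2 ((n : ℝ) + 1)) :
    Summable fun k => 2 ^ k * ∑ n ∈ Finset.Ico (blockEnd k) (blockEnd (k + 1)), b n := by
  set w : ℕ → ℝ := fun n => b n * Real.logb 2 ((n : ℝ) + 1)
  have hw : ∀ n, 0 ≤ w n := fun n => mul_nonneg (hb n) (logb_two_natCast_add_one_nonneg n)
  have hblock : ∀ k, 2 ^ k * ∑ n ∈ Finset.Ico (blockEnd k) (blockEnd (k + 1)), b n ≤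
      ∑ n ∈ Finset.Ico (blockEnd k) (blockEnd (k + 1)), w n := fun k => by
    rw [mul_comm, Finset.sum_mul]
    exact Finset.sum_le_sum fun n hn =>
      mul_le_mul_of_nonneg_left (two_pow_le_logb (Finset.mem_Ico.1 hn).1) (hb n)
  refine summable_of_sum_range_le (c := ∑' n, w n)
    (fun k => mul_nonneg (by positivity) (Finset.sum_nonneg fun n _ => hb n)) fun K => ?_
  calc _ ≤ ∑ k ∈ Finset.range K, ∑ n ∈ Finset.Ico (blockEnd k) (blockEnd (k + 1)), w n :=
        Finset.sum_le_sum fun k _ => hblock k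
    _ = ∑ n ∈ Finset.Ico (blockEnd 0) (blockEnd K), w n :=
        sum_range_sum_Ico strictMono_blockEnd.monotone w K
    _ ≤ ∑' n, w n := hsum.sum_le_tsum _ fun n _ => hw n

lemma summable_card_block_div_exp : Summable fun k =>
    ((Finset.Ico (blockEnd k) (blockEnd (k + 1))).card : ℝ) / Real.exp (4 * 2 ^ k) := by
  refine Summable.of_nonneg_of_le (fun k => by positivity) (fun k => ?_) Real.summable_exp_neg_nat
  have hcard : ((Finset.Ico (blockEnd k) (blockEnd (k + 1))).card : ℝ) ≤ Real.exp (2 ^ (k + 1)) :=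
    le_trans (by simp) (blockEnd_le_exp (k + 1))
  have hk : (k : ℝ) ≤ 2 ^ (k + 1) := by
    exact_mod_cast (Nat.lt_two_pow_self.trans_le (Nat.pow_le_pow_right two_pos k.le_succ)).le
  calc _ ≤ Real.exp (2 ^ (k + 1)) / Real.exp (4 * 2 ^ k) := by gcongr
    _ = Real.exp (-2 ^ (k + 1)) := by
      rw [← Real.exp_sub]
      ring_nf
    _ ≤ Real.exp (-k) := by gcongr

end Blocks

section Integral

variable {Ω : Type*} {m0 : MeasurableSpace Ω} {μ : Measure Ω}

lemma ae_summable_of_summable_integral {g : ℕ → Ω → ℝ} (hg : ∀ n, Integrable (g n) μ)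
    (hg0 : ∀ n, 0 ≤ᵐ[μ] g n) (hsum : Summable fun n => ∫ x, g n x ∂μ) :
    ∀ᵐ x ∂μ, Summable fun n => g n x := by
  have hnorm : ∀ n, eLpNorm (g n) 1 μ = ENNReal.ofReal (∫ x, g n x ∂μ) := fun n => by
    rw [eLpNorm_one_eq_lintegral_enorm, ← ofReal_integral_norm_eq_lintegral_enorm (hg n)]
    congr 1
    refine integral_congr_ae ?_
    filter_upwards [hg0 n] with x hx using Real.norm_of_nonneg hx
  have hfin : ∑' n, eLpNorm (g n) 1 μ ≠ ⊤ := by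
    simp_rw [hnorm]
    rw [← ENNReal.ofReal_tsum_of_nonneg (fun n => integral_nonneg_of_ae (hg0 n)) hsum]
    exact ENNReal.ofReal_ne_top
  filter_upwards [summable_norm_of_tsum_eLpNorm_ne_top le_rfl
    (fun n => (hg n).aestronglyMeasurable) hfin] with x hx using hx.of_norm

lemma ae_eventually_forall_mem_le {ι : Type*} {s : ℕ → Finset ι} {g : ℕ → ι → Ω → ℝ} {r : ℕ → ℝ}
    {C : ℝ} (hr : ∀ k, 0 < r k) (hg : ∀ k i, Integrable (g k i) μ) (hg0 : ∀ k i x, 0 ≤ g k i x)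
    (hgC : ∀ k i, ∫ x, g k i x ∂μ ≤ C) (hsum : Summable fun k => ((s k).card : ℝ) / r k) :
    ∀ᵐ x ∂μ, ∀ᶠ k in atTop, ∀ i ∈ s k, g k i x ≤ r k := by
  set G : ℕ → Ω → ℝ := fun k x => (∑ i ∈ s k, g k i x) / r k
  have hG0 : ∀ k x, 0 ≤ G k x := fun k x =>
    div_nonneg (Finset.sum_nonneg fun i _ => hg0 k i x) (hr k).le
  have hGint : ∀ k, ∫ x, G k x ∂μ ≤ C * ((s k).card / r k) := fun k => by
    rw [integral_div, integral_finsetSum _ fun i _ => hg k i, ← mul_div_assoc, mul_comm C]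
    have hcard := Finset.sum_le_card_nsmul (s k) _ C fun i _ => hgC k i
    rw [nsmul_eq_mul] at hcard
    exact div_le_div_of_nonneg_right hcard (hr k).le
  have hGsum : Summable fun k => ∫ x, G k x ∂μ :=
    Summable.of_nonneg_of_le (fun k => integral_nonneg (hG0 k)) hGint (hsum.mul_left C)
  filter_upwards [ae_summable_of_summable_integral
    (fun k => (integrable_finsetSum _ fun i _ => hg k i).div_const _)
    (fun k => ae_of_all _ (hG0 k)) hGsum] with x hx
  filter_upwards [hx.tendsto_atTop_zero.eventually (ge_mem_nhds zero_lt_one)] with k hk i hi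
  exact (Finset.single_le_sum (fun j _ => hg0 k j x) hi).trans ((div_le_one (hr k)).1 hk)

lemma integral_sum_sq_of_orthogonal {ι : Type*} {φ : ι → Ω → ℝ} (hφ : ∀ i, MemLp (φ i) 2 μ)
    (horth : Pairwise fun i j => ∫ x, φ i x * φ j x ∂μ = 0) (s : Finset ι) :
    ∫ x, (∑ i ∈ s, φ i x) ^ 2 ∂μ = ∑ i ∈ s, ∫ x, φ i x ^ 2 ∂μ := by
  have hint : ∀ i j, Integrable (fun x => φ i x * φ j x) μ := fun i j =>
    (hφ i).integrable_mul (hφ j)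
  simp_rw [pow_two, Finset.sum_mul_sum]
  rw [integral_finsetSum _ fun i _ => integrable_finsetSum _ fun j _ => hint i j]
  refine Finset.sum_congr rfl fun i hi => ?_
  rw [integral_finsetSum _ fun j _ => hint i j]
  exact Finset.sum_eq_single_of_mem i hi fun j _ hji => horth hji.symm

lemma integral_sq_eq_one_of_eLpNorm_eq_one {g : Ω → ℝ} (hg : AEStronglyMeasurable g μ)
    (hnorm : eLpNorm g 2 μ = 1) : ∫ x, g x ^ 2 ∂μ = 1 := by
  have hLp : MemLp g 2 μ := ⟨hg, hnorm ▸ ENNReal.one_lt_top⟩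
  have hroot := hLp.eLpNorm_eq_integral_rpow_norm two_ne_zero ENNReal.ofNat_ne_top
  simp only [ENNReal.toReal_ofNat, Real.rpow_two, Real.norm_eq_abs, sq_abs] at hroot
  rwa [hnorm, eq_comm, ENNReal.ofReal_eq_one,
    Real.rpow_inv_eq (integral_nonneg fun x => sq_nonneg (g x)) zero_le_one two_ne_zero,
    Real.one_rpow] at hroot

end Integral

section ConditionalExpectation

variable {Ω : Type*} {m m0 : MeasurableSpace Ω} {μ : Measure Ω}

lemma integral_mul_le_of_condExp_le_one (hm : m ≤ m0) [SigmaFinite (μ.trim hm)] {G e : Ω → ℝ}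
    (hGm : AEStronglyMeasurable[m] G μ) (hG0 : 0 ≤ᵐ[μ] G) (hG : Integrable G μ)
    (he : Integrable e μ) (hGe : Integrable (G * e) μ) (hle : μ[e | m] ≤ᵐ[μ] 1) :
    ∫ x, G x * e x ∂μ ≤ ∫ x, G x ∂μ := by
  have hpull : μ[G * e | m] =ᵐ[μ] G * μ[e | m] :=
    condExp_mul_of_aestronglyMeasurable_left hGm hGe he
  calc ∫ x, G x * e x ∂μ = ∫ x, (μ[G * e | m]) x ∂μ := (integral_condExp hm).symm
    _ ≤ ∫ x, G x ∂μ := by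
      refine integral_mono_ae integrable_condExp hG ?_
      filter_upwards [hpull, hG0, hle] with x hx hGx hex
      rw [hx]
      exact mul_le_of_le_one_right hGx hex

lemma ae_condExp_sq_nonneg {d : Ω → ℝ} (m : MeasurableSpace Ω) :
    ∀ᵐ x ∂μ, 0 ≤ (μ[fun y => d y ^ 2 | m]) x :=
  condExp_nonneg (ae_of_all _ fun x => sq_nonneg (d x))

lemma condExp_one_add_add_sq (hm : m ≤ m0) [IsFiniteMeasure μ] {d : Ω → ℝ} (hd : MemLp d 2 μ)
    (hd0 : μ[d | m] =ᵐ[μ] 0) (t : ℝ) :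
    μ[fun x => 1 + t * d x + t ^ 2 * d x ^ 2 | m] =ᵐ[μ]
      fun x => 1 + t ^ 2 * (μ[fun y => d y ^ 2 | m]) x := by
  have hlin : Integrable (t • d) μ := (hd.integrable one_le_two).smul t
  have hone : Integrable (fun _ => (1 : ℝ)) μ := integrable_const 1
  filter_upwards [condExp_add (hone.add hlin) (hd.integrable_sq.smul (t ^ 2)) m,
    condExp_add hone hlin m, condExp_smul t d m, condExp_smul (t ^ 2) (fun x => d x ^ 2) m, hd0]
    with x hadd hadd' hsmul hsmul' hx0
  refine hadd.trans ?_
  simp [hadd', hsmul, hsmul', hx0, condExp_const hm]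

lemma condExp_exp_le_one (hm : m ≤ m0) [IsFiniteMeasure μ] {d : Ω → ℝ} (hd : MemLp d 2 μ)
    (hd0 : μ[d | m] =ᵐ[μ] 0) (t : ℝ)
    (hint : Integrable
      (fun x => Real.exp (t * d x - t ^ 2 * (d x ^ 2 + (μ[fun y => d y ^ 2 | m]) x))) μ) :
    μ[fun x => Real.exp (t * d x - t ^ 2 * (d x ^ 2 + (μ[fun y => d y ^ 2|m]) x)) | m] ≤ᵐ[μ] 1 := by
  set V := μ[fun y => d y ^ 2 | m]
  set W : Ω → ℝ := fun x => Real.exp (-(t ^ 2 * V x))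
  set h : Ω → ℝ := fun x => 1 + t * d x + t ^ 2 * d x ^ 2
  have hWm : StronglyMeasurable[m] W :=
    Real.continuous_exp.comp_stronglyMeasurable (stronglyMeasurable_condExp.const_mul _).neg
  have hW1 : ∀ᵐ x ∂μ, ‖W x‖ ≤ 1 := by
    filter_upwards [ae_condExp_sq_nonneg (d := d) m] with x hx
    rw [Real.norm_of_nonneg (Real.exp_nonneg _), Real.exp_le_one_iff]
    exact neg_nonpos.2 (mul_nonneg (sq_nonneg t) hx)
  have hh : Integrable h μ := ((integrable_const 1).add
    ((hd.integrable one_le_two).const_mul t)).add (hd.integrable_sq.const_mul (t ^ 2))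
  have hWh : Integrable (W * h) μ :=
    hh.bdd_mul (hWm.mono hm).aestronglyMeasurable hW1
  have hbound : ∀ x, Real.exp (t * d x - t ^ 2 * (d x ^ 2 + V x)) ≤ (W * h) x := fun x => by
    calc Real.exp (t * d x - t ^ 2 * (d x ^ 2 + V x))
        = W x * Real.exp (t * d x - (t * d x) ^ 2) := by
          rw [← Real.exp_add]
          ring_nf
      _ ≤ W x * h x := by
          refine mul_le_mul_of_nonneg_left ?_ (Real.exp_nonneg _)
          simpa only [mul_pow] using exp_sub_sq_le (t * d x)
  filter_upwards [condExp_mono (m := m) hint hWh (ae_of_all _ hbound),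
    condExp_stronglyMeasurable_mul_of_bound hm hWm hh 1 hW1, condExp_one_add_add_sq hm hd hd0 t]
    with x hmono hpull hcond
  calc _ ≤ (μ[W * h | m]) x := hmono
    _ = W x * (1 + t ^ 2 * V x) := by rw [hpull, Pi.mul_apply, hcond]
    _ ≤ W x * Real.exp (t ^ 2 * V x) := by
      refine mul_le_mul_of_nonneg_left ?_ (Real.exp_nonneg _)
      linarith [Real.add_one_le_exp (t ^ 2 * V x)]
    _ = 1 := by rw [← Real.exp_add, neg_add_cancel, Real.exp_zero]

end ConditionalExpectation

/-- A square-integrable martingale difference sequence adapted to `ℱ`. The first term is only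
required to be measurable and square-integrable, and measurability is up to null sets. -/
structure IsL2MartingaleDifference {Ω : Type*} {m0 : MeasurableSpace Ω} (ℱ : Filtration ℕ m0)
    (μ : Measure Ω) (d : ℕ → Ω → ℝ) : Prop where
  aestronglyMeasurable : ∀ n, AEStronglyMeasurable[ℱ n] (d n) μ
  memLp : ∀ n, MemLp (d n) 2 μ
  condExp_succ : ∀ n, μ[d (n + 1) | ℱ n] =ᵐ[μ] 0

/-- The increment `dₙ² + 𝔼[dₙ² | ℱₙ₋₁]` of the sum of the total and the predictable quadratic
variations. By truncated subtraction, for `n = 0` the conditioning is on `ℱ 0`. -/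
noncomputable def quadIncr {Ω : Type*} {m0 : MeasurableSpace Ω} (ℱ : Filtration ℕ m0)
    (μ : Measure Ω) (d : ℕ → Ω → ℝ) (n : ℕ) (x : Ω) : ℝ :=
  d n x ^ 2 + (μ[fun y => d n y ^ 2 | ℱ (n - 1)]) x

/-- The increment of the exponent of the exponential supermartingale
`exp (t ∑ dₙ - t² ∑ (dₙ² + 𝔼[dₙ² | ℱₙ₋₁]))`. -/
noncomputable def expoIncr {Ω : Type*} {m0 : MeasurableSpace Ω} (ℱ : Filtration ℕ m0)
    (μ : Measure Ω) (d : ℕ → Ω → ℝ) (t : ℝ) (n : ℕ) (x : Ω) : ℝ :=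
  t * d n x - t ^ 2 * quadIncr ℱ μ d n x

section Increments

variable {Ω : Type*} {m0 : MeasurableSpace Ω} {μ : Measure Ω} {ℱ : Filtration ℕ m0}
  {d : ℕ → Ω → ℝ}

lemma ae_quadIncr_nonneg (n : ℕ) : ∀ᵐ x ∂μ, 0 ≤ quadIncr ℱ μ d n x := by
  filter_upwards [ae_condExp_sq_nonneg (d := d n) (ℱ (n - 1))] with x hx using
    add_nonneg (sq_nonneg _) hx

lemma ae_expoIncr_le (t : ℝ) (n : ℕ) : ∀ᵐ x ∂μ, expoIncr ℱ μ d t n x ≤ 1 / 4 := by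
  filter_upwards [ae_condExp_sq_nonneg (d := d n) (ℱ (n - 1))] with x hx
  rw [expoIncr, quadIncr]
  nlinarith [sq_nonneg (t * d n x - 1 / 2), mul_nonneg (sq_nonneg t) hx]

lemma sum_expoIncr {ι : Type*} (σ : ι → ℕ) (t : ℝ) (s : Finset ι) (x : Ω) :
    ∑ i ∈ s, expoIncr ℱ μ d t (σ i) x =
      t * ∑ i ∈ s, d (σ i) x - t ^ 2 * ∑ i ∈ s, quadIncr ℱ μ d (σ i) x := by
  simp only [expoIncr, Finset.sum_sub_distrib, Finset.mul_sum]

lemma ae_exp_sum_expoIncr_le {ι : Type*} (σ : ι → ℕ) (t : ℝ) (s : Finset ι) :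
    ∀ᵐ x ∂μ, ‖Real.exp (∑ i ∈ s, expoIncr ℱ μ d t (σ i) x)‖ ≤ Real.exp (s.card • (1 / 4)) := by
  have hall : ∀ᵐ x ∂μ, ∀ n, expoIncr ℱ μ d t n x ≤ 1 / 4 := ae_all_iff.2 (ae_expoIncr_le t)
  filter_upwards [hall] with x hx
  rw [Real.norm_of_nonneg (Real.exp_nonneg _)]
  exact Real.exp_le_exp.2 (Finset.sum_le_card_nsmul _ _ _ fun i _ => hx (σ i))

end Increments

namespace IsL2MartingaleDifference

variable {Ω : Type*} {m0 : MeasurableSpace Ω} {μ : Measure Ω} {ℱ : Filtration ℕ m0}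
  {d : ℕ → Ω → ℝ}

lemma const_mul (h : IsL2MartingaleDifference ℱ μ d) (c : ℕ → ℝ) :
    IsL2MartingaleDifference ℱ μ fun n x => c n * d n x where
  aestronglyMeasurable n := (h.aestronglyMeasurable n).const_mul (c n)
  memLp n := (h.memLp n).const_mul (c n)
  condExp_succ n := by
    filter_upwards [condExp_smul (c (n + 1)) (d (n + 1)) (ℱ n), h.condExp_succ n] with x hx hx0
    refine hx.trans ?_
    simp [hx0]

lemma integral_mul_eq_zero_of_lt [IsFiniteMeasure μ] (h : IsL2MartingaleDifference ℱ μ d)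
    {m n : ℕ} (hmn : m < n) : ∫ x, d m x * d n x ∂μ = 0 := by
  obtain ⟨n, rfl⟩ := Nat.exists_eq_add_one_of_ne_zero (Nat.ne_zero_of_lt hmn)
  have hpull : μ[d m * d (n + 1) | ℱ n] =ᵐ[μ] d m * μ[d (n + 1) | ℱ n] :=
    condExp_mul_of_aestronglyMeasurable_left
      ((h.aestronglyMeasurable m).mono (ℱ.mono (Nat.lt_succ_iff.1 hmn)))
      ((h.memLp m).integrable_mul (h.memLp (n + 1))) ((h.memLp (n + 1)).integrable one_le_two)
  calc ∫ x, d m x * d (n + 1) x ∂μ = ∫ x, (μ[d m * d (n + 1) | ℱ n]) x ∂μ :=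
        (integral_condExp (ℱ.le n)).symm
    _ = 0 := by
      refine integral_eq_zero_of_ae ?_
      filter_upwards [hpull, h.condExp_succ n] with x hx hx0
      rw [hx, Pi.mul_apply, hx0, Pi.zero_apply, mul_zero]

lemma pairwise_integral_mul_eq_zero [IsFiniteMeasure μ] (h : IsL2MartingaleDifference ℱ μ d) :
    Pairwise fun m n => ∫ x, d m x * d n x ∂μ = 0 := fun m n hmn => by
  rcases hmn.lt_or_gt with hlt | hgt
  · exact h.integral_mul_eq_zero_of_lt hlt
  · simpa only [mul_comm] using h.integral_mul_eq_zero_of_lt hgt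

lemma aestronglyMeasurable_quadIncr (h : IsL2MartingaleDifference ℱ μ d) (n : ℕ) :
    AEStronglyMeasurable[ℱ n] (quadIncr ℱ μ d n) μ :=
  ((h.aestronglyMeasurable n).pow 2).add
    (stronglyMeasurable_condExp.mono (ℱ.mono (n.sub_le 1))).aestronglyMeasurable

lemma aestronglyMeasurable_expoIncr (h : IsL2MartingaleDifference ℱ μ d) (t : ℝ) (n : ℕ) :
    AEStronglyMeasurable[ℱ n] (expoIncr ℱ μ d t n) μ :=
  ((h.aestronglyMeasurable n).const_mul t).sub
    ((h.aestronglyMeasurable_quadIncr n).const_mul (t ^ 2))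

lemma integrable_quadIncr (h : IsL2MartingaleDifference ℱ μ d) (n : ℕ) :
    Integrable (quadIncr ℱ μ d n) μ :=
  (h.memLp n).integrable_sq.add integrable_condExp

lemma integral_quadIncr [IsFiniteMeasure μ] (h : IsL2MartingaleDifference ℱ μ d) (n : ℕ) :
    ∫ x, quadIncr ℱ μ d n x ∂μ = 2 * ∫ x, d n x ^ 2 ∂μ := by
  simp only [quadIncr]
  rw [integral_add (h.memLp n).integrable_sq integrable_condExp, integral_condExp (ℱ.le _),
    two_mul]

lemma integrable_exp_sum_expoIncr [IsFiniteMeasure μ] (h : IsL2MartingaleDifference ℱ μ d)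
    {ι : Type*} (σ : ι → ℕ) (t : ℝ) (s : Finset ι) :
    Integrable (fun x => Real.exp (∑ i ∈ s, expoIncr ℱ μ d t (σ i) x)) μ :=
  Integrable.of_bound (Real.continuous_exp.comp_aestronglyMeasurable
    (Finset.aestronglyMeasurable_fun_sum s fun i _ =>
      (h.aestronglyMeasurable_expoIncr t (σ i)).mono (ℱ.le _))) _ (ae_exp_sum_expoIncr_le σ t s)

lemma integral_exp_sum_insert_le [IsFiniteMeasure μ] (h : IsL2MartingaleDifference ℱ μ d)
    {ι : Type*} [DecidableEq ι] {σ : ι → ℕ} (t : ℝ) {s : Finset ι} {a : ι} {n : ℕ}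
    (ha : σ a = n + 1) (has : a ∉ s) (hs : ∀ i ∈ s, σ i ≤ n) :
    ∫ x, Real.exp (∑ i ∈ insert a s, expoIncr ℱ μ d t (σ i) x) ∂μ ≤
      ∫ x, Real.exp (∑ i ∈ s, expoIncr ℱ μ d t (σ i) x) ∂μ := by
  have hprod : ∀ x, Real.exp (∑ i ∈ insert a s, expoIncr ℱ μ d t (σ i) x) =
      Real.exp (∑ i ∈ s, expoIncr ℱ μ d t (σ i) x) * Real.exp (expoIncr ℱ μ d t (n + 1) x) :=
    fun x => by rw [Finset.sum_insert has, ha, add_comm, Real.exp_add]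
  have hlast : Integrable (fun x => Real.exp (expoIncr ℱ μ d t (n + 1) x)) μ := by
    simpa using h.integrable_exp_sum_expoIncr id t {n + 1}
  have hpast : AEStronglyMeasurable[ℱ n]
      (fun x => Real.exp (∑ i ∈ s, expoIncr ℱ μ d t (σ i) x)) μ := by
    have hsum : AEStronglyMeasurable[ℱ n] (∑ i ∈ s, expoIncr ℱ μ d t (σ i)) μ :=
      Finset.sum_induction _ (AEStronglyMeasurable[ℱ n] · μ) (fun _ _ => .add)
        aestronglyMeasurable_zero fun i hi =>
          (h.aestronglyMeasurable_expoIncr t (σ i)).mono (ℱ.mono (hs i hi))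
    simpa only [Finset.sum_apply] using Real.continuous_exp.comp_aestronglyMeasurable hsum
  simp_rw [hprod]
  exact integral_mul_le_of_condExp_le_one (ℱ.le n) hpast (ae_of_all _ fun x => Real.exp_nonneg _)
    (h.integrable_exp_sum_expoIncr σ t s) hlast
    ((h.integrable_exp_sum_expoIncr σ t (insert a s)).congr (ae_of_all _ hprod))
    (condExp_exp_le_one (ℱ.le n) (h.memLp (n + 1)) (h.condExp_succ n) t hlast)

lemma integral_exp_sum_expoIncr_le [IsFiniteMeasure μ] (h : IsL2MartingaleDifference ℱ μ d)
    {ι : Type*} {σ : ι → ℕ} (hσ : Function.Injective σ) (t : ℝ) (s : Finset ι) :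
    ∫ x, Real.exp (∑ i ∈ s, expoIncr ℱ μ d t (σ i) x) ∂μ ≤ μ.real Set.univ * Real.exp (1 / 4) := by
  classical
  induction s using Finset.induction_on_max_value σ with
  | empty =>
    simpa using le_mul_of_one_le_right measureReal_nonneg (Real.one_le_exp (by norm_num))
  | insert a s has hmax ih =>
    have hlt : ∀ i ∈ s, σ i < σ a := fun i hi =>
      (hmax i hi).lt_of_ne (hσ.ne (ne_of_mem_of_not_mem hi has))
    rcases Nat.eq_zero_or_eq_succ_pred (σ a) with h0 | hsucc
    · have hs : s = ∅ := Finset.eq_empty_of_forall_notMem fun i hi => by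
        simpa [h0] using hlt i hi
      calc _ ≤ ∫ _, Real.exp (1 / 4) ∂μ := by
            refine integral_mono_ae (h.integrable_exp_sum_expoIncr σ t _) (integrable_const _) ?_
            filter_upwards [ae_expoIncr_le (ℱ := ℱ) (d := d) t (σ a)] with x hx
            simpa [hs] using hx
        _ = _ := by simp
    · exact (h.integral_exp_sum_insert_le t hsucc has fun i hi =>
        Nat.le_pred_of_lt (hlt i hi)).trans ih

lemma ae_eventually_abs_sum_le [IsFiniteMeasure μ] (h : IsL2MartingaleDifference ℱ μ d)
    {σ : ℕ → ℕ} (hσ : Function.Injective σ) {L : ℝ} (hL : 0 < L) :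
    ∀ᵐ x ∂μ, ∀ᶠ k in atTop, ∀ m ∈ Finset.Ico (blockEnd k) (blockEnd (k + 1)),
      |∑ n ∈ Finset.Ico (blockEnd k) m, d (σ n) x| ≤
        4 / L + L * (2 ^ k * ∑ n ∈ Finset.Ico (blockEnd k) m, quadIncr ℱ μ d (σ n) x) := by
  have hexp : ∀ c : ℝ, ∀ᵐ x ∂μ, ∀ᶠ k in atTop,
      ∀ m ∈ Finset.Ico (blockEnd k) (blockEnd (k + 1)),
        Real.exp (∑ n ∈ Finset.Ico (blockEnd k) m, expoIncr ℱ μ d (c * 2 ^ k) (σ n) x) ≤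
          Real.exp (4 * 2 ^ k) := fun c =>
    ae_eventually_forall_mem_le (fun k => Real.exp_pos _)
      (fun k m => h.integrable_exp_sum_expoIncr σ _ _) (fun k m x => Real.exp_nonneg _)
      (fun k m => h.integral_exp_sum_expoIncr_le hσ _ _) summable_card_block_div_exp
  filter_upwards [hexp L, hexp (-L)] with x hpos hneg
  filter_upwards [hpos, hneg] with k hk hk' m hm
  have hupper := Real.exp_le_exp.1 (hk m hm)
  have hlower := Real.exp_le_exp.1 (hk' m hm)
  rw [sum_expoIncr] at hupper hlower
  rw [neg_mul L] at hlower
  refine (abs_le_of_mul_sub_sq_mul_le (by positivity) hupper hlower).trans_eq ?_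
  rw [mul_div_mul_right _ _ (by positivity), mul_assoc]

lemma ae_summable_two_pow_mul_sq_sum_block [IsFiniteMeasure μ]
    (h : IsL2MartingaleDifference ℱ μ d) {σ : ℕ → ℕ} (hσ : Function.Injective σ)
    (hsum : Summable fun k =>
      2 ^ k * ∑ n ∈ Finset.Ico (blockEnd k) (blockEnd (k + 1)), ∫ x, d (σ n) x ^ 2 ∂μ) :
    ∀ᵐ x ∂μ, Summable fun k : ℕ =>
      2 ^ k * (∑ n ∈ Finset.Ico (blockEnd k) (blockEnd (k + 1)), d (σ n) x) ^ 2 := by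
  refine ae_summable_of_summable_integral (fun k =>
    (memLp_finsetSum _ fun n _ => h.memLp (σ n)).integrable_sq.const_mul _)
    (fun k => ae_of_all _ fun x => by positivity) (hsum.congr fun k => ?_)
  rw [integral_const_mul, integral_sum_sq_of_orthogonal (fun n => h.memLp (σ n))
    fun i j hij => h.pairwise_integral_mul_eq_zero (hσ.ne hij)]

lemma ae_summable_two_pow_mul_sum_quadIncr [IsFiniteMeasure μ]
    (h : IsL2MartingaleDifference ℱ μ d) {σ : ℕ → ℕ}
    (hsum : Summable fun k =>
      2 ^ k * ∑ n ∈ Finset.Ico (blockEnd k) (blockEnd (k + 1)), ∫ x, d (σ n) x ^ 2 ∂μ) :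
    ∀ᵐ x ∂μ, Summable fun k : ℕ =>
      2 ^ k * ∑ n ∈ Finset.Ico (blockEnd k) (blockEnd (k + 1)), quadIncr ℱ μ d (σ n) x := by
  refine ae_summable_of_summable_integral
    (fun k => (integrable_finsetSum _ fun n _ => h.integrable_quadIncr (σ n)).const_mul _)
    (fun k => ?_) ((hsum.mul_left 2).congr fun k => ?_)
  · filter_upwards [ae_all_iff.2 (ae_quadIncr_nonneg (ℱ := ℱ) (d := d))] with x hx
    exact mul_nonneg (by positivity) (Finset.sum_nonneg fun n _ => hx (σ n))
  · rw [integral_const_mul, integral_finsetSum _ fun n _ => h.integrable_quadIncr (σ n)]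
    simp only [h.integral_quadIncr, ← Finset.mul_sum]
    ring

theorem ae_exists_tendsto_sum_comp [IsFiniteMeasure μ] (h : IsL2MartingaleDifference ℱ μ d)
    {σ : ℕ → ℕ} (hσ : Function.Injective σ)
    (hsum : Summable fun n : ℕ => (∫ x, d (σ n) x ^ 2 ∂μ) * Real.logb 2 ((n : ℝ) + 1)) :
    ∀ᵐ x ∂μ, ∃ s, Tendsto (fun N => ∑ n ∈ Finset.range N, d (σ n) x) atTop (𝓝 s) := by
  have hblock := summable_two_pow_mul_block
    (fun n => integral_nonneg fun x => sq_nonneg (d (σ n) x)) hsum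
  have hosc : ∀ᵐ x ∂μ, ∀ L : ℕ, ∀ᶠ k in atTop, ∀ m ∈ Finset.Ico (blockEnd k) (blockEnd (k + 1)),
      |∑ n ∈ Finset.Ico (blockEnd k) m, d (σ n) x| ≤ 4 / (L + 1) +
        (L + 1) * (2 ^ k * ∑ n ∈ Finset.Ico (blockEnd k) m, quadIncr ℱ μ d (σ n) x) :=
    ae_all_iff.2 fun L => h.ae_eventually_abs_sum_le hσ L.cast_add_one_pos
  filter_upwards [h.ae_summable_two_pow_mul_sq_sum_block hσ hblock,
    h.ae_summable_two_pow_mul_sum_quadIncr hblock, hosc,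
    ae_all_iff.2 (ae_quadIncr_nonneg (ℱ := ℱ) (d := d))] with x hsq hquad hosc hnonneg
  refine exists_tendsto_sum_range_of_blocks strictMono_blockEnd
    (summable_of_summable_mul_sq (fun k => by positivity)
      (by simpa using summable_geometric_two) hsq)
    (eventually_forall_mem_le_of_tendsto_zero (C := 4) hquad.tendsto_atTop_zero fun L => ?_)
  filter_upwards [hosc L] with k hk m hm
  have hmono : ∑ n ∈ Finset.Ico (blockEnd k) m, quadIncr ℱ μ d (σ n) x ≤
      ∑ n ∈ Finset.Ico (blockEnd k) (blockEnd (k + 1)), quadIncr ℱ μ d (σ n) x :=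
    Finset.sum_le_sum_of_subset_of_nonneg (Finset.Ico_subset_Ico_right (Finset.mem_Ico.1 hm).2.le)
      fun n _ _ => hnonneg (σ n)
  exact (hk m hm).trans (by gcongr)

theorem ae_exists_tendsto_sum_mul_comp [IsFiniteMeasure μ] (h : IsL2MartingaleDifference ℱ μ d)
    {σ : ℕ → ℕ} (hσ : Function.Injective σ) {a : ℕ → ℝ}
    (hsum : Summable fun n : ℕ =>
      a n ^ 2 * (∫ x, d (σ n) x ^ 2 ∂μ) * Real.logb 2 ((n : ℝ) + 1)) :
    ∀ᵐ x ∂μ, ∃ s, Tendsto (fun N => ∑ n ∈ Finset.range N, a n * d (σ n) x) atTop (𝓝 s) := by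
  have hext := (h.const_mul (Function.extend σ a 0)).ae_exists_tendsto_sum_comp hσ
  simp only [hσ.extend_apply, mul_pow, integral_const_mul] at hext
  exact hext hsum

end IsL2MartingaleDifference

instance : IsProbabilityMeasure unitMeasure := ⟨by simp [unitMeasure]⟩

namespace IsPartition

variable {P : Set (Set ℝ)} {A : Set ℝ} {g : ℝ → ℝ}

lemma subset_Ico (hP : IsPartition P) (hA : A ∈ P) : A ⊆ Set.Ico 0 1 :=
  hP.sUnion_eq ▸ Set.subset_sUnion_of_mem hA

lemma isPiSystem (hP : IsPartition P) : IsPiSystem P := fun A hA B hB hAB => by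
  rwa [hP.pairwiseDisjoint.eq hA hB (Set.not_disjoint_iff_nonempty_inter.2 hAB), Set.inter_self]

lemma generateFrom_le (hP : IsPartition P) :
    MeasurableSpace.generateFrom P ≤ Real.measurableSpace :=
  MeasurableSpace.generateFrom_le hP.measurableSet

lemma measurableSet_sUnion (hP : IsPartition P) {S : Set (Set ℝ)} (hS : S ⊆ P) :
    MeasurableSet[MeasurableSpace.generateFrom P] (⋃₀ S) :=
  .sUnion (hP.countable.mono hS) fun _ hA => MeasurableSpace.measurableSet_generateFrom (hS hA)

lemma measurable_indicator (hP : IsPartition P) (hg : ∀ A ∈ P, ∀ x ∈ A, ∀ y ∈ A, g x = g y) :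
    Measurable[MeasurableSpace.generateFrom P] ((Set.Ico 0 1).indicator g) := fun t _ => by
  have hIco : MeasurableSet[MeasurableSpace.generateFrom P] (Set.Ico (0 : ℝ) 1) :=
    hP.sUnion_eq ▸ hP.measurableSet_sUnion subset_rfl
  have hpre : g ⁻¹' t ∩ Set.Ico 0 1 = ⋃₀ {A ∈ P | A ⊆ g ⁻¹' t} := by
    rw [← hP.sUnion_eq]
    ext x
    constructor
    · rintro ⟨hxt, A, hA, hxA⟩
      exact ⟨A, ⟨hA, fun y hy => by rwa [Set.mem_preimage, hg A hA y hy x hxA]⟩, hxA⟩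
    · rintro ⟨A, ⟨hA, hAt⟩, hxA⟩
      exact ⟨hAt hxA, A, hA, hxA⟩
  rw [Set.indicator_preimage, Set.ite, hpre]
  exact (hP.measurableSet_sUnion (Set.sep_subset _ _)).union
    ((MeasurableSet.const ((0 : ℝ) ∈ t)).diff hIco)

lemma aestronglyMeasurable_of_const_on (hP : IsPartition P)
    (hg : ∀ A ∈ P, ∀ x ∈ A, ∀ y ∈ A, g x = g y) :
    AEStronglyMeasurable[MeasurableSpace.generateFrom P] g unitMeasure :=
  ⟨_, (hP.measurable_indicator hg).stronglyMeasurable,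
    (indicator_ae_eq_restrict measurableSet_Ico).symm⟩

lemma setIntegral_unitMeasure (hP : IsPartition P) (hA : A ∈ P) :
    ∫ x in A, g x ∂unitMeasure = ∫ x in A, g x := by
  rw [unitMeasure, Measure.restrict_restrict_of_subset (hP.subset_Ico hA)]

lemma integral_eq_zero (hP : IsPartition P) (hg : Integrable g unitMeasure)
    (hg0 : ∀ A ∈ P, ∫ x in A, g x = 0) : ∫ x, g x ∂unitMeasure = 0 := by
  have : Countable P := hP.countable.to_subtype
  have hcover : ⋃ A : P, (A : Set ℝ) = Set.Ico 0 1 := by rw [← Set.sUnion_eq_iUnion, hP.sUnion_eq]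
  calc ∫ x, g x ∂unitMeasure = ∫ x in ⋃ A : P, (A : Set ℝ), g x := by rw [hcover, unitMeasure]
    _ = ∑' A : P, ∫ x in (A : Set ℝ), g x :=
      integral_iUnion (fun A => hP.measurableSet A A.2)
        (fun A B hAB => hP.pairwiseDisjoint A.2 B.2 (Subtype.coe_ne_coe.2 hAB)) (hcover ▸ hg)
    _ = 0 := by simp [hg0]

lemma setIntegral_eq_zero (hP : IsPartition P) (hg : Integrable g unitMeasure)
    (hg0 : ∀ A ∈ P, ∫ x in A, g x = 0) {s : Set ℝ}
    (hs : MeasurableSet[MeasurableSpace.generateFrom P] s) : ∫ x in s, g x ∂unitMeasure = 0 := by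
  induction s, hs using MeasurableSpace.induction_on_inter rfl hP.isPiSystem with
  | empty => simp
  | basic A hA => rw [hP.setIntegral_unitMeasure hA, hg0 A hA]
  | compl s hs ih => rw [setIntegral_compl (hP.generateFrom_le s hs) hg, hP.integral_eq_zero hg hg0,
    ih, sub_zero]
  | iUnion s hdisj hs ih =>
    rw [integral_iUnion (fun i => hP.generateFrom_le _ (hs i)) hdisj hg.integrableOn]
    simp [ih]

lemma condExp_generateFrom_eq_zero (hP : IsPartition P) (hg : Integrable g unitMeasure)
    (hg0 : ∀ A ∈ P, ∫ x in A, g x = 0) :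
    unitMeasure[g | MeasurableSpace.generateFrom P] =ᵐ[unitMeasure] 0 :=
  (ae_eq_condExp_of_forall_setIntegral_eq hP.generateFrom_le hg
    (fun _ _ _ => integrableOn_zero) (fun s hs _ => by simp [hP.setIntegral_eq_zero hg hg0 hs])
    aestronglyMeasurable_zero).symm

end IsPartition

/-- The filtration of σ-algebras generated by a filtration of partitions. -/
def IsFiltration.filtration {𝒜 : ℕ → Set (Set ℝ)} (h𝒜 : IsFiltration 𝒜) :
    Filtration ℕ Real.measurableSpace where
  seq n := MeasurableSpace.generateFrom (𝒜 n)
  mono' := monotone_nat_of_le_succ fun n => MeasurableSpace.generateFrom_le fun A hA => by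
    obtain ⟨S, hS, rfl⟩ := h𝒜.union_of_next n A hA
    exact (h𝒜.isPartition (n + 1)).measurableSet_sUnion hS
  le' n := (h𝒜.isPartition n).generateFrom_le

lemma IsMartingaleDifference.isL2MartingaleDifference {𝒜 : ℕ → Set (Set ℝ)} {f : ℕ → ℝ → ℝ}
    (hf : IsMartingaleDifference 𝒜 f) (hL2 : ∀ n, MemLp (f n) 2 unitMeasure) :
    IsL2MartingaleDifference hf.isFiltration.filtration unitMeasure f where
  aestronglyMeasurable n :=
    (hf.isFiltration.isPartition n).aestronglyMeasurable_of_const_on (hf.const_on n)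
  memLp := hL2
  condExp_succ n := (hf.isFiltration.isPartition n).condExp_generateFrom_eq_zero
    (hf.integrable (n + 1)) (hf.integral_eq_zero n)

end GenHaar

theorem corollary2_general {𝒜 : ℕ → Set (Set ℝ)} {f : ℕ → ℝ → ℝ}
    (hf : GenHaar.IsMartingaleDifference 𝒜 f)
    (hnorm : ∀ n, eLpNorm (f n) 2 GenHaar.unitMeasure = 1) {σ : ℕ → ℕ}
    (hσ : Function.Injective σ) :
    GenHaar.IsCMultiplier (fun n : ℕ => Real.logb 2 ((n : ℝ) + 1)) (fun n => f (σ n)) := by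
  have hL2 : ∀ n, MemLp (f n) 2 GenHaar.unitMeasure := fun n =>
    ⟨(hf.integrable n).aestronglyMeasurable, hnorm n ▸ ENNReal.one_lt_top⟩
  have hsq : ∀ n, ∫ x, f n x ^ 2 ∂GenHaar.unitMeasure = 1 := fun n =>
    GenHaar.integral_sq_eq_one_of_eLpNorm_eq_one (hL2 n).aestronglyMeasurable (hnorm n)
  have hmd := hf.isL2MartingaleDifference hL2
  exact
    { orthonormal :=
        { memLp := fun n => hL2 (σ n)
          norm_eq_one := fun n => hsq (σ n)
          orthogonal := fun m n hmn => hmd.pairwise_integral_mul_eq_zero (hσ.ne hmn) }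
      nonneg := GenHaar.logb_two_natCast_add_one_nonneg
      monotone := GenHaar.monotone_logb_two_natCast_add_one
      tendsto_atTop := GenHaar.tendsto_logb_two_natCast_add_one_atTop
      ae_convergent := fun a ha => hmd.ae_exists_tendsto_sum_mul_comp hσ (by simpa [hsq] using ha) }

/-- The `n`-th term (`n = 0, 1, 2, …`) of the rearranged system is given the weight
`log₂ (n + 1)`. -/
theorem corollary2 (f : ℕ → ℝ → ℝ) (hf : GenHaar.IsGeneralizedHaarSystem f)
    (σ : Equiv.Perm ℕ) :
    GenHaar.IsCMultiplier (fun n : ℕ => Real.logb 2 ((n : ℝ) + 1)) (fun n => f (σ n)) := by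
  obtain ⟨_, _, hmd, hnorm⟩ := hf
  exact corollary2_general hmd hnorm σ.injective
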